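/- Let $(X,g)$ be an admissible Riemannian polyhedron of dimension $m$: a connected space $X$ with a homeomorphism $\theta:|K|\to X$, where $K$ is a locally finite simplicial complex affinely embedded in a Euclidean space, such that every simplex of $K$ is a face of an $m$-simplex, every connected open subset of $X$ stays connected after removal of the $(m-2)$-skeleton, and every $m$-simplex carries a Riemannian metric which, in affine coordinates, is continuous (and positive definite) up to the boundary. Let $N$ be a Hermitian manifold without boundary, that is, a complex manifold with a smooth Riemannian metric invariant under the complex structure. "Almost everywhere" on $X$ means outside a set which meets every open $m$-simplex in a set of Lebesgue measure zero. On open $m$-simplexes, $\nabla$ and $\langle\cdot,\cdot\rangle$ denote the weak gradient and the inner product of $g$. Let $d_X$ be the intrinsic distance of $(X,g)$ and $\mu_g$ its Riemannian volume. For a complex manifold $M$ with a Riemannian metric and Riemannian distance $d_M$, a continuous map $\varphi:O\to M$ on an open set $O\subseteq X$ is of class $W^{1,2}_{loc}(O,M)$ if, for every domain $U$ with compact closure contained in $O$, $$\sup_{f\in C_c(U,[0,1])}\ \limsup_{\varepsilon\to0^+}\int_U f(x)\int_{\{x'\in U:\ d_X(x,x')<\varepsilon\}}\frac{d_M(\varphi(x),\varphi(x'))^2}{\varepsilon^{m+2}}\,d\mu_g(x')\,d\mu_g(x)<\infty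 .$$ A continuous map $\varphi:O\to M$ of class $W^{1,2}_{loc}(O,M)$ is called pseudo-horizontally weakly conformal if for all holomorphic functions $v=v_1+iv_2:V\to\mathbf C$ and $w=w_1+iw_2:W\to\mathbf C$ on open sets $V,W\subseteq M$, almost everywhere in $\varphi^{-1}(V\cap W)$, $$\langle\nabla(w_1\circ\varphi),\nabla(v_1\circ\varphi)\rangle-\langle\nabla(w_2\circ\varphi),\nabla(v_2\circ\varphi)\rangle=0,$$ $$\langle\nabla(w_2\circ\varphi),\nabla(v_1\circ\varphi)\rangle+\langle\nabla(w_1\circ\varphi),\nabla(v_2\circ\varphi)\rangle=0,$$ where the weak gradients are part of the requirement: they exist on each open $m$-simplex (within $\varphi^{-1}(V\cap W)$). Proposition 3.5. Let $\varphi:X\to N$ be a continuous map of class $W^{1,2}_{loc}(X,N)$. Then $\varphi$ is pseudo-horizontally weakly conformal if and only if, for every open set $V\subseteq N$ and every holomorphic function $\psi:V\to\mathbf C$, the map $\psi\circ\varphi:\varphi^{-1}(V)\to\mathbf C$ (with the Euclidean metric on $\mathbf C$) is pseudo-horizontally weakly conformal. -/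

import Mathlib

open Set Filter Topology MeasureTheory Manifold Bundle
open scoped ENNReal NNReal ContDiff Matrix

noncomputable section

/-! ### Admissible Riemannian polyhedra -/

/-- The open standard simplex of `ℝ^m`. -/
def openStdSimplex (m : ℕ) : Set (Fin m → ℝ) :=
  {x | (∀ i, 0 < x i) ∧ ∑ i, x i < 1}

/-- The closed standard simplex of `ℝ^m`. -/
def closedStdSimplex (m : ℕ) : Set (Fin m → ℝ) :=
  {x | (∀ i, 0 ≤ x i) ∧ ∑ i, x i ≤ 1}

/-- An admissible Riemannian polyhedron structure of dimension `m` on the topological space `X`: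
a triangulation `θ : |K| → X` of the connected space `X` by a locally finite simplicial complex `K`,
affinely embedded in a Euclidean space `ℝ^d`, which is dimensionally homogeneous of dimension `m`
and `(m-1)`-chainable, together with a Riemannian metric `g` on every `m`-simplex, given in
Euclidean coordinates and continuous up to the boundary of the simplex. No compatibility between
the metrics of different `m`-simplices along common faces is required. By compactness of the
simplex, continuity and positive definiteness of `g` contain the ellipticity condition
`Λ⁻² |ξ|² ≤ g(ξ, ξ) ≤ Λ² |ξ|²` on each simplex. -/
structure AdmissibleRiemannianPolyhedron (X : Type*) [TopologicalSpace X] (m : ℕ) where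
  /-- the dimension of the ambient Euclidean space -/
  d : ℕ
  /-- the simplicial complex -/
  K : Geometry.SimplicialComplex ℝ (EuclideanSpace ℝ (Fin d))
  locallyFinite : ∀ p ∈ K.space, ∃ W ∈ 𝓝 p,
    {s | s ∈ K.faces ∧ (convexHull ℝ (s : Set (EuclideanSpace ℝ (Fin d))) ∩ W).Nonempty}.Finite
  /-- the triangulation -/
  θ : K.space ≃ₜ X
  connected : ConnectedSpace X
  /-- dimensional homogeneity -/
  homogeneous : ∀ s ∈ K.faces, ∃ t ∈ K.faces, s ⊆ t ∧ t.card = m + 1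
  /-- removing the `(m-2)`-skeleton does not disconnect connected open sets -/
  chainable : ∀ U : Set X, IsOpen U → IsConnected U →
    IsConnected {p | p ∈ U ∧ ∀ s ∈ K.faces, s.card < m →
      ((θ.symm p : K.space) : EuclideanSpace ℝ (Fin d)) ∉
        convexHull ℝ (s : Set (EuclideanSpace ℝ (Fin d)))}
  /-- an enumeration of the vertices of every `m`-simplex, which fixes Euclidean (affine)
  coordinates on it -/
  vert : {s : Finset (EuclideanSpace ℝ (Fin d)) // s ∈ K.faces ∧ s.card = m + 1} →
    Fin (m + 1) → EuclideanSpace ℝ (Fin d)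
  range_vert : ∀ s, range (vert s) = (s.1 : Set (EuclideanSpace ℝ (Fin d)))
  /-- the components `g_ij` of the metric on an `m`-simplex in these coordinates -/
  g : {s : Finset (EuclideanSpace ℝ (Fin d)) // s ∈ K.faces ∧ s.card = m + 1} →
    (Fin m → ℝ) → Matrix (Fin m) (Fin m) ℝ
  g_continuous : ∀ s, ContinuousOn (g s) (closedStdSimplex m)
  g_posDef : ∀ s, ∀ x ∈ closedStdSimplex m, (g s x).PosDef

namespace AdmissibleRiemannianPolyhedron

variable {X : Type*} [TopologicalSpace X] {m : ℕ} (P : AdmissibleRiemannianPolyhedron X m)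

/-- The ambient Euclidean space of the complex. -/
abbrev Amb : Type := EuclideanSpace ℝ (Fin P.d)

/-- The maximal simplexes, i.e. the `m`-simplexes of the complex. -/
abbrev Top : Type := {s : Finset P.Amb // s ∈ P.K.faces ∧ s.card = m + 1}

/-- The position in the Euclidean space of a point of `X`. -/
def pos (p : X) : P.Amb := (P.θ.symm p : P.K.space)

/-- The affine parametrization of an `m`-simplex of `K` by the standard simplex of `ℝ^m`. -/
def affineMap (s : P.Top) (x : Fin m → ℝ) : P.Amb :=
  P.vert s 0 + ∑ i : Fin m, x i • (P.vert s i.succ - P.vert s 0)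

theorem vert_zero_mem (s : P.Top) : P.vert s 0 ∈ P.K.space := by
  refine P.K.subset_space s.2.1 ?_
  rw [← P.range_vert s]
  exact mem_range_self 0

open Classical in
/-- The parametrization of an `m`-simplex of `X` by the standard simplex of `ℝ^m` (only its
restriction to the closed standard simplex is meaningful). -/
def param (s : P.Top) (x : Fin m → ℝ) : X :=
  if h : P.affineMap s x ∈ P.K.space then P.θ ⟨P.affineMap s x, h⟩
  else P.θ ⟨P.vert s 0, P.vert_zero_mem s⟩

/-- The open `m`-simplex `Δ°` as a subset of `X`. -/
def openSimplex (s : P.Top) : Set X := P.param s '' openStdSimplex m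

/-- The Euclidean coordinates on the open `m`-simplex `Δ°`. -/
def coords (s : P.Top) (p : X) : Fin m → ℝ :=
  Function.invFunOn (P.param s) (openStdSimplex m) p

/-- The integral over `X` of a function with values in `[0, ∞]` with respect to the Riemannian
volume `μ_g`, which is `√(det g) dx` on every open `m`-simplex. -/
def volIntegral (F : X → ℝ≥0∞) : ℝ≥0∞ :=
  ∑' s : P.Top, ∫⁻ x in openStdSimplex m,
    F (P.param s x) * ENNReal.ofReal (√((P.g s x).det))

/-- Null sets: the sets meeting every maximal simplex in a set of Lebesgue measure zero. -/
def IsNull (Z : Set X) : Prop :=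
  ∀ s : P.Top, volume {x | x ∈ openStdSimplex m ∧ P.param s x ∈ Z} = 0

/-- The `(m-1)`-skeleton, i.e. the complement of the union of the open `m`-simplexes. As the metric is continuous on every
`m`-simplex, all points of open `m`-simplexes are Lebesgue points of the metric. -/
def skeleton : Set X := {p | ∀ s : P.Top, p ∉ P.openSimplex s}

/-- Lipschitz continuous paths, parametrized by `[0, 1]`. -/
def IsLipPath (γ : ℝ → X) : Prop :=
  ∃ C : ℝ≥0, LipschitzOnWith C (fun t => P.pos (γ t)) (Icc 0 1)

/-- A path is transversal to `Z` if it spends time zero in `Z`. -/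
def IsTransversalPath (γ : ℝ → X) (Z : Set X) : Prop :=
  volume {t | t ∈ Icc (0 : ℝ) 1 ∧ γ t ∈ Z} = 0

/-- The length of a path with respect to the metric `g`, measured in the open `m`-simplexes. -/
def pathLength (γ : ℝ → X) : ℝ≥0∞ :=
  ∑' s : P.Top, ∫⁻ t in {t | t ∈ Icc (0 : ℝ) 1 ∧ γ t ∈ P.openSimplex s},
    ENNReal.ofReal (√(deriv (fun τ => P.coords s (γ τ)) t ⬝ᵥ
      (P.g s (P.coords s (γ t)) *ᵥ deriv (fun τ => P.coords s (γ τ)) t)))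

/-- The intrinsic distance `d_X`: the supremum, over the null sets `Z` containing the skeleton, of
the infimum of the lengths of the Lipschitz paths from `p` to `q` which are transversal to `Z`. -/
def intrinsicDist (p q : X) : ℝ≥0∞ :=
  ⨆ (Z : Set X) (_ : P.IsNull Z) (_ : P.skeleton ⊆ Z),
    ⨅ (γ : ℝ → X) (_ : γ 0 = p) (_ : γ 1 = q) (_ : P.IsLipPath γ) (_ : IsTransversalPath γ Z),
      P.pathLength γ

/-! ### Energy and maps locally of finite energy -/

section Energy

variable {Y : Type*}

open Classical in
/-- The approximate energy density at `p` of the restriction of `φ` to `U`, for a target with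
distance function `dY`:
the integral over `q ∈ B(p, ε) ∩ U` of `dY (φ p) (φ q) ^ 2 / ε ^ (m + 2)`. -/
def approxEnergyDensity (dY : Y → Y → ℝ≥0∞) (U : Set X) (φ : X → Y) (ε : ℝ) (p : X) : ℝ≥0∞ :=
  P.volIntegral fun q =>
    if q ∈ U ∧ P.intrinsicDist p q < ENNReal.ofReal ε then
      dY (φ p) (φ q) ^ 2 / ENNReal.ofReal ε ^ (m + 2)
    else 0

/-- The Korevaar–Schoen energy of the restriction of `φ` to the open set `U`, i.e. the supremum over
`f ∈ C_c(U, [0, 1])` of the upper limits, as `ε → 0+`, of the integrals of `f` against the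
approximate energy densities. -/
def energy (dY : Y → Y → ℝ≥0∞) (U : Set X) (φ : X → Y) : ℝ≥0∞ :=
  ⨆ (f : X → ℝ) (_ : Continuous f) (_ : HasCompactSupport f) (_ : tsupport f ⊆ U)
    (_ : ∀ p, f p ∈ Icc (0 : ℝ) 1),
      limsup (fun ε : ℝ => P.volIntegral fun p =>
        ENNReal.ofReal (f p) * P.approxEnergyDensity dY U φ ε p) (𝓝[>] 0)

/-- A continuous map on the open set `O` is of class `W^{1,2}_loc` (locally of finite energy) if its
restriction to every domain `U` which is relatively compact in `O` has finite energy. (For a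
continuous map, membership in `L²_loc` is automatic.) -/
def IsW12LocDist (dY : Y → Y → ℝ≥0∞) (O : Set X) (φ : X → Y) : Prop :=
  ∀ U : Set X, IsOpen U → IsConnected U → IsCompact (closure U) → closure U ⊆ O →
    P.energy dY U φ < ⊤

end Energy

/-! ### Weak gradients -/

/-- The gradient vector, in the coordinates of the simplex `s` at the point `x`, of a function with
differential `ξ`, that is, `∇^i = g^{ij} ξ_j`. -/
def gradOfDiff (s : P.Top) (x : Fin m → ℝ) (ξ : Fin m → ℝ) : Fin m → ℝ :=
  (P.g s x)⁻¹ *ᵥ ξ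

/-- The inner product `⟨a, b⟩ = g_ij a^i b^j` of tangent vectors at the point `x` of `s`. -/
def metricInner (s : P.Top) (x : Fin m → ℝ) (a b : Fin m → ℝ) : ℝ :=
  a ⬝ᵥ (P.g s x *ᵥ b)

end AdmissibleRiemannianPolyhedron

/-- `D = (∂_1 u, …, ∂_m u)` is the weak differential of `u` on the open set `Ω ⊆ ℝ^m`, in the sense
of distributions. -/
def HasWeakDiff {m : ℕ} (Ω : Set (Fin m → ℝ)) (u : (Fin m → ℝ) → ℝ)
    (D : (Fin m → ℝ) → Fin m → ℝ) : Prop :=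
  LocallyIntegrableOn u Ω ∧ LocallyIntegrableOn D Ω ∧
    ∀ η : (Fin m → ℝ) → ℝ, ContDiff ℝ ((⊤ : ℕ∞) : WithTop ℕ∞) η → HasCompactSupport η → tsupport η ⊆ Ω →
      ∀ i, ∫ x, u x * fderiv ℝ η x (Pi.single i 1) = - ∫ x, D x i * η x

/-! ### Hermitian manifolds and local holomorphic functions -/

section Hermitian

/-- The real manifold underlying a complex manifold is analytic. -/
instance isManifold_real_of_complex {E : Type*} [NormedAddCommGroup E] [NormedSpace ℂ E]
    {N : Type*} [TopologicalSpace N] [ChartedSpace E N] [IsManifold 𝓘(ℂ, E) ω N] :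
    IsManifold 𝓘(ℝ, E) ω N := by
  refine isManifold_of_contDiffOn 𝓘(ℝ, E) ω N fun e e' he he' => ?_
  have h := (contDiffGroupoid ω 𝓘(ℂ, E)).compatible he he'
  rw [contDiffGroupoid, mem_groupoid_of_pregroupoid] at h
  exact h.1.restrict_scalars ℝ

variable (E : Type*) [NormedAddCommGroup E] [NormedSpace ℂ E]
  (N : Type*) [TopologicalSpace N] [ChartedSpace E N]

/-- The complex structure `J` of a tangent space of a complex manifold. -/
def complexStructure (x : N) (v : TangentSpace 𝓘(ℝ, E) x) : TangentSpace 𝓘(ℝ, E) x :=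
  show E from Complex.I • (show E from v)

/-- A Riemannian metric on a complex manifold is Hermitian if `g (J v) (J w) = g v w`. -/
def IsHermitianMetric [RiemannianBundle (fun x : N => TangentSpace 𝓘(ℝ, E) x)] : Prop :=
  ∀ (x : N) (v w : TangentSpace 𝓘(ℝ, E) x),
    inner ℝ (complexStructure E N x v) (complexStructure E N x w) = inner ℝ v w

variable {N}

/-- `ψ` is holomorphic (complex analytic) on the open set `V`. -/
def IsLocalHolomorphic (V : Set N) (ψ : N → ℂ) : Prop :=
  IsOpen V ∧ ContMDiffOn 𝓘(ℂ, E) 𝓘(ℂ, ℂ) ω ψ V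

end Hermitian

/-! ### Pseudo-horizontally weakly conformal maps -/

namespace AdmissibleRiemannianPolyhedron

variable {X : Type*} [TopologicalSpace X] {m : ℕ} (P : AdmissibleRiemannianPolyhedron X m)
  (E : Type*) [NormedAddCommGroup E] [NormedSpace ℂ E]
  {N : Type*} [TopologicalSpace N] [ChartedSpace E N]

/-- The class `W^{1,2}_loc(O, N)` for a complex manifold `N` with a Riemannian metric, which carries
the distance induced by the metric. -/
def IsW12Loc [RiemannianBundle (fun x : N => TangentSpace 𝓘(ℝ, E) x)]
    (O : Set X) (φ : X → N) : Prop :=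
  P.IsW12LocDist (riemannianEDist 𝓘(ℝ, E)) O φ

/-- The identities of pseudo-horizontal weak conformality for the map `φ` on the open set `O` and
two functions `v = v₁ + i v₂` and `w = w₁ + i w₂` on `N`: on every open `m`-simplex, the functions
`v_k ∘ φ` and `w_k ∘ φ` have weak differentials (necessarily unique up to null sets), and the
corresponding gradients satisfy
`⟨∇(w₁ ∘ φ), ∇(v₁ ∘ φ)⟩ - ⟨∇(w₂ ∘ φ), ∇(v₂ ∘ φ)⟩ = 0` and
`⟨∇(w₂ ∘ φ), ∇(v₁ ∘ φ)⟩ + ⟨∇(w₁ ∘ φ), ∇(v₂ ∘ φ)⟩ = 0` almost everywhere in `O`. -/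
def ConformalPair {N : Type*} (O : Set X) (φ : X → N) (v w : N → ℂ) : Prop :=
  ∀ s : P.Top, ∃ dv₁ dv₂ dw₁ dw₂ : (Fin m → ℝ) → Fin m → ℝ,
    HasWeakDiff (openStdSimplex m ∩ P.param s ⁻¹' O) (fun x => (v (φ (P.param s x))).re) dv₁ ∧
    HasWeakDiff (openStdSimplex m ∩ P.param s ⁻¹' O) (fun x => (v (φ (P.param s x))).im) dv₂ ∧
    HasWeakDiff (openStdSimplex m ∩ P.param s ⁻¹' O) (fun x => (w (φ (P.param s x))).re) dw₁ ∧
    HasWeakDiff (openStdSimplex m ∩ P.param s ⁻¹' O) (fun x => (w (φ (P.param s x))).im) dw₂ ∧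
    ∀ᵐ x, x ∈ openStdSimplex m ∩ P.param s ⁻¹' O →
      P.metricInner s x (P.gradOfDiff s x (dw₁ x)) (P.gradOfDiff s x (dv₁ x)) -
        P.metricInner s x (P.gradOfDiff s x (dw₂ x)) (P.gradOfDiff s x (dv₂ x)) = 0 ∧
      P.metricInner s x (P.gradOfDiff s x (dw₂ x)) (P.gradOfDiff s x (dv₁ x)) +
        P.metricInner s x (P.gradOfDiff s x (dw₁ x)) (P.gradOfDiff s x (dv₂ x)) = 0

/-- A map `φ : O → N` on an open set `O` of the polyhedron (values of `φ` outside `O` are irrelevant)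
is pseudo-horizontally weakly conformal if it is continuous, of class `W^{1,2}_loc`, and satisfies
the identities above for all local holomorphic functions `v` on `V` and `w` on `W`, almost
everywhere where both `v ∘ φ` and `w ∘ φ` are defined. -/
def IsPHWC [RiemannianBundle (fun x : N => TangentSpace 𝓘(ℝ, E) x)]
    (O : Set X) (φ : X → N) : Prop :=
  ContinuousOn φ O ∧ P.IsW12Loc E O φ ∧
    ∀ (V W : Set N) (v w : N → ℂ), IsLocalHolomorphic E V v → IsLocalHolomorphic E W w →
      P.ConformalPair (O ∩ φ ⁻¹' (V ∩ W)) φ v w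

end AdmissibleRiemannianPolyhedron

end

/-! ### Weak differentials -/

/-! Let B be the complex bilinear extension of g. The two identities are the real and imaginary
parts of B(∇(w∘φ), ∇(v∘φ)) = 0.

Forward: the identities of ψ∘φ for v, w are those of φ for v∘ψ, w∘ψ, which are again holomorphic.
Finite energy passes to ψ∘φ because ψ is Lipschitz for the Riemannian distance on the compact image
of the closure of U (`IsLocalHolomorphic.exists_edist_le_riemannianEDist_of_isCompact`), and a
Lipschitz constant C costs at most a factor C² (`energy_comp_le`).

Converse: testing ψ∘φ with the identity of ℂ gives B(∇(ψ∘φ), ∇(ψ∘φ)) = 0. Taking ψ = v, w, v + w on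
V ∩ W and polarizing the symmetric form B gives the mixed identity (`ConformalPair.polarize`). -/

theorem MeasureTheory.LocallyIntegrableOn.integrable_mul_of_tsupport_subset
    {Y : Type*} [TopologicalSpace Y] [T2Space Y] [MeasurableSpace Y] [OpensMeasurableSpace Y]
    {μ : Measure Y} {Ω : Set Y} {u η : Y → ℝ} (hu : LocallyIntegrableOn u Ω μ)
    (hη : Continuous η) (hc : HasCompactSupport η) (hΩ : tsupport η ⊆ Ω) :
    Integrable (fun x => u x * η x) μ := by
  have h := (hu.integrableOn_compact_subset hΩ hc).mul_continuousOn hη.continuousOn hc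
  refine (integrableOn_iff_integrable_of_support_subset fun x hx => ?_).1 h
  exact subset_tsupport η fun h0 => hx (by simp [h0])

theorem MeasureTheory.LocallyIntegrableOn.eval {Y ι : Type*} [TopologicalSpace Y]
    [MeasurableSpace Y] [Fintype ι] {μ : Measure Y} {Ω : Set Y} {D : Y → ι → ℝ}
    (hD : LocallyIntegrableOn D Ω μ) (i : ι) : LocallyIntegrableOn (fun x => D x i) Ω μ := by
  intro x hx
  obtain ⟨t, ht, h⟩ := hD x hx
  exact ⟨t, ht, Integrable.eval h i⟩

namespace HasWeakDiff

variable {m : ℕ} {Ω : Set (Fin m → ℝ)} {u v : (Fin m → ℝ) → ℝ} {D D' : (Fin m → ℝ) → Fin m → ℝ}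

theorem add (hu : HasWeakDiff Ω u D) (hv : HasWeakDiff Ω v D') :
    HasWeakDiff Ω (fun x => u x + v x) (fun x => D x + D' x) := by
  refine ⟨hu.1.add hv.1, hu.2.1.add hv.2.1, fun η hη hc hs i => ?_⟩
  have hη' : Continuous fun x => fderiv ℝ η x (Pi.single i 1) :=
    (hη.continuous_fderiv (by simp)).clm_apply continuous_const
  have hc' : HasCompactSupport fun x => fderiv ℝ η x (Pi.single i 1) :=
    hc.fderiv_apply ℝ _
  have hs' : tsupport (fun x => fderiv ℝ η x (Pi.single i 1)) ⊆ Ω :=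
    (tsupport_fderiv_apply_subset ℝ _).trans hs
  simp only [add_mul, Pi.add_apply]
  rw [integral_add (hu.1.integrable_mul_of_tsupport_subset hη' hc' hs')
      (hv.1.integrable_mul_of_tsupport_subset hη' hc' hs'),
    integral_add ((hu.2.1.eval i).integrable_mul_of_tsupport_subset hη.continuous hc hs)
      ((hv.2.1.eval i).integrable_mul_of_tsupport_subset hη.continuous hc hs),
    hu.2.2 η hη hc hs i, hv.2.2 η hη hc hs i, neg_add]

/-- Weak differentials on an open set are unique up to null sets. -/
theorem ae_unique (hΩ : IsOpen Ω) (hD : HasWeakDiff Ω u D) (hD' : HasWeakDiff Ω u D') :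
    ∀ᵐ x, x ∈ Ω → D x = D' x := by
  have key : ∀ i, ∀ᵐ x, x ∈ Ω → D x i - D' x i = 0 := fun i => by
    -- Fundamental lemma of the calculus of variations, applied to each component.
    refine hΩ.ae_eq_zero_of_integral_contDiff_smul_eq_zero
      ((hD.2.1.eval i).sub (hD'.2.1.eval i)) fun η hη hc hs => ?_
    have h := (hD.2.2 η hη hc hs i).symm.trans (hD'.2.2 η hη hc hs i)
    simp only [smul_eq_mul, mul_comm (η _), sub_mul]
    rw [integral_sub ((hD.2.1.eval i).integrable_mul_of_tsupport_subset hη.continuous hc hs)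
      ((hD'.2.1.eval i).integrable_mul_of_tsupport_subset hη.continuous hc hs)]
    linarith
  filter_upwards [ae_all_iff.2 key] with x hx hxΩ
  exact funext fun i => sub_eq_zero.1 (hx i hxΩ)

end HasWeakDiff

namespace AdmissibleRiemannianPolyhedron

variable {X : Type*} [TopologicalSpace X] {m : ℕ} (P : AdmissibleRiemannianPolyhedron X m)

/-! ### The parametrization of the simplexes -/

theorem affineMap_mem_space (s : P.Top) {x : Fin m → ℝ} (hx : x ∈ closedStdSimplex m) :
    P.affineMap s x ∈ P.K.space := by
  refine P.K.convexHull_subset_space s.2.1 ?_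
  have hmem : ∀ j, P.vert s j ∈ convexHull ℝ (s.1 : Set P.Amb) := fun j =>
    subset_convexHull ℝ _ (P.range_vert s ▸ mem_range_self j)
  -- Barycentric coordinates: vertex 0 takes the remaining weight 1 - ∑ xᵢ.
  have hsum : P.affineMap s x =
      ∑ j, (Fin.cons (1 - ∑ i, x i) x : Fin (m + 1) → ℝ) j • P.vert s j := by
    simp only [affineMap, Fin.sum_univ_succ, Fin.cons_zero, Fin.cons_succ, smul_sub,
      Finset.sum_sub_distrib, sub_smul, one_smul, Finset.sum_smul]
    abel
  rw [hsum]
  refine (convex_convexHull ℝ _).sum_mem (fun j _ => ?_) ?_ fun j _ => hmem j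
  · refine Fin.cases ?_ (fun i => ?_) j
    · simpa using hx.2
    · simpa using hx.1 i
  · simp [Fin.sum_univ_succ]

theorem openStdSimplex_subset_closed : openStdSimplex m ⊆ closedStdSimplex m :=
  fun _ hx => ⟨fun i => (hx.1 i).le, hx.2.le⟩

theorem isOpen_openStdSimplex : IsOpen (openStdSimplex m) := by
  have : openStdSimplex m = (⋂ i, {x | 0 < x i}) ∩ {x | ∑ i, x i < 1} := by
    ext x; simp [openStdSimplex]
  rw [this]
  exact (isOpen_iInter_of_finite fun i => isOpen_lt continuous_const (continuous_apply i)).inter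
    (isOpen_lt (by fun_prop) continuous_const)

theorem continuousOn_param (s : P.Top) : ContinuousOn (P.param s) (closedStdSimplex m) := by
  rw [continuousOn_iff_continuous_domRestrict]
  have : (closedStdSimplex m).domRestrict (P.param s) =
      fun x : closedStdSimplex m => P.θ ⟨P.affineMap s x, P.affineMap_mem_space s x.2⟩ := by
    ext x
    simp [param, P.affineMap_mem_space s x.2]
  rw [this]
  refine P.θ.continuous.comp (Continuous.subtype_mk ?_ _)
  exact continuous_const.add <| continuous_finsetSum _ fun i _ =>
    ((continuous_apply i).comp continuous_subtype_val).smul continuous_const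

theorem isOpen_openStdSimplex_inter_preimage (s : P.Top) {O : Set X} (hO : IsOpen O) :
    IsOpen (openStdSimplex m ∩ P.param s ⁻¹' O) :=
  ((P.continuousOn_param s).mono openStdSimplex_subset_closed).isOpen_inter_preimage
    isOpen_openStdSimplex hO

/-! ### The inner product of gradients -/

section Inner

variable (s : P.Top) (x : Fin m → ℝ)

theorem metricInner_grad_add_left (a b c : Fin m → ℝ) :
    P.metricInner s x (P.gradOfDiff s x (a + b)) (P.gradOfDiff s x c) =
      P.metricInner s x (P.gradOfDiff s x a) (P.gradOfDiff s x c) +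
        P.metricInner s x (P.gradOfDiff s x b) (P.gradOfDiff s x c) := by
  simp only [metricInner, gradOfDiff, Matrix.mulVec_add, add_dotProduct]

theorem metricInner_grad_add_right (a b c : Fin m → ℝ) :
    P.metricInner s x (P.gradOfDiff s x a) (P.gradOfDiff s x (b + c)) =
      P.metricInner s x (P.gradOfDiff s x a) (P.gradOfDiff s x b) +
        P.metricInner s x (P.gradOfDiff s x a) (P.gradOfDiff s x c) := by
  simp only [metricInner, gradOfDiff, Matrix.mulVec_add, dotProduct_add]

variable {x}

theorem metricInner_comm (hx : x ∈ closedStdSimplex m) (a b : Fin m → ℝ) :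
    P.metricInner s x a b = P.metricInner s x b a := by
  have h : (P.g s x)ᵀ = P.g s x := by
    simpa [Matrix.IsHermitian, Matrix.conjTranspose_eq_transpose_of_trivial] using
      (P.g_posDef s x hx).1
  rw [metricInner, metricInner, Matrix.dotProduct_mulVec, ← Matrix.mulVec_transpose, h,
    dotProduct_comm]

end Inner

/-! ### Polarization of conformality -/

/-- B(v+w, v+w) - B(v, v) - B(w, w) = 2 B(w, v), since B is symmetric. -/
theorem ConformalPair.polarize {N : Type*} {O : Set X} (hO : IsOpen O) {φ : X → N} {v w : N → ℂ}
    (hv : P.ConformalPair O φ v v) (hw : P.ConformalPair O φ w w)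
    (hvw : P.ConformalPair O φ (v + w) (v + w)) : P.ConformalPair O φ v w := by
  intro s
  have hΩ := P.isOpen_openStdSimplex_inter_preimage s hO
  obtain ⟨a₁, a₂, a₁', a₂', ha₁, ha₂, ha₁', ha₂', ha⟩ := hv s
  obtain ⟨b₁, b₂, b₁', b₂', hb₁, hb₂, hb₁', hb₂', hb⟩ := hw s
  obtain ⟨c₁, c₂, c₁', c₂', hc₁, hc₂, hc₁', hc₂', hc⟩ := hvw s
  refine ⟨a₁, a₂, b₁, b₂, ha₁, ha₂, hb₁, hb₂, ?_⟩
  -- Each hypothesis supplies its own weak differentials, even twice for the same function;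
  -- uniqueness reduces all of them to a, b and a + b.
  filter_upwards [ha, hb, hc, ha₁'.ae_unique hΩ ha₁, ha₂'.ae_unique hΩ ha₂,
    hb₁'.ae_unique hΩ hb₁, hb₂'.ae_unique hΩ hb₂,
    hc₁.ae_unique hΩ (ha₁.add hb₁), hc₂.ae_unique hΩ (ha₂.add hb₂),
    hc₁'.ae_unique hΩ (ha₁.add hb₁), hc₂'.ae_unique hΩ (ha₂.add hb₂)]
    with x ha hb hc e₁ e₂ e₃ e₄ e₅ e₆ e₇ e₈ hx
  obtain ⟨ha, ha'⟩ := ha hx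
  obtain ⟨hb, hb'⟩ := hb hx
  obtain ⟨hc, hc'⟩ := hc hx
  rw [e₁ hx, e₂ hx] at ha ha'
  rw [e₃ hx, e₄ hx] at hb hb'
  rw [e₅ hx, e₆ hx, e₇ hx, e₈ hx] at hc hc'
  simp only [metricInner_grad_add_left, metricInner_grad_add_right] at hc hc'
  have hsymm := P.metricInner_comm s (openStdSimplex_subset_closed hx.1)
  have h₁ := hsymm (P.gradOfDiff s x (a₁ x)) (P.gradOfDiff s x (b₁ x))
  have h₂ := hsymm (P.gradOfDiff s x (a₂ x)) (P.gradOfDiff s x (b₂ x))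
  have h₃ := hsymm (P.gradOfDiff s x (a₁ x)) (P.gradOfDiff s x (b₂ x))
  have h₄ := hsymm (P.gradOfDiff s x (a₂ x)) (P.gradOfDiff s x (b₁ x))
  constructor <;> linarith

/-! ### Energy of compositions with Lipschitz maps -/

theorem volIntegral_mono {F G : X → ℝ≥0∞} (h : ∀ p, F p ≤ G p) :
    P.volIntegral F ≤ P.volIntegral G := by
  unfold volIntegral
  gcongr
  exact h _

/-- Finiteness of c replaces measurability of F, which is not available for energy densities. -/
theorem volIntegral_const_mul {c : ℝ≥0∞} (hc : c ≠ ⊤) (F : X → ℝ≥0∞) :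
    P.volIntegral (fun p => c * F p) = c * P.volIntegral F := by
  simp only [volIntegral, mul_assoc, lintegral_const_mul' c _ hc, ENNReal.tsum_mul_left]

variable {Y Z : Type*} {dY : Y → Y → ℝ≥0∞} {dZ : Z → Z → ℝ≥0∞} {U : Set X} {φ : X → Y} {ψ : Y → Z}
  {C : ℝ≥0}

theorem approxEnergyDensity_comp_le
    (h : ∀ p ∈ U, ∀ q ∈ U, dZ (ψ (φ p)) (ψ (φ q)) ≤ C * dY (φ p) (φ q)) (ε : ℝ) {p : X}
    (hp : p ∈ U) :
    P.approxEnergyDensity dZ U (ψ ∘ φ) ε p ≤ C ^ 2 * P.approxEnergyDensity dY U φ ε p := by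
  rw [approxEnergyDensity, approxEnergyDensity, ← P.volIntegral_const_mul (by simp)]
  refine P.volIntegral_mono fun q => ?_
  split_ifs with hq
  · rw [← mul_div_assoc, ← mul_pow]
    gcongr
    exact h p hp q hq.1
  · simp

theorem energy_comp_le
    (h : ∀ p ∈ U, ∀ q ∈ U, dZ (ψ (φ p)) (ψ (φ q)) ≤ C * dY (φ p) (φ q)) :
    P.energy dZ U (ψ ∘ φ) ≤ C ^ 2 * P.energy dY U φ := by
  refine iSup_le fun f => iSup_le fun hf => iSup_le fun hc => iSup_le fun hs => iSup_le fun h01 => ?_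
  calc limsup (fun ε : ℝ => P.volIntegral fun p =>
        ENNReal.ofReal (f p) * P.approxEnergyDensity dZ U (ψ ∘ φ) ε p) (𝓝[>] 0)
      ≤ limsup (fun ε : ℝ => C ^ 2 * P.volIntegral fun p =>
        ENNReal.ofReal (f p) * P.approxEnergyDensity dY U φ ε p) (𝓝[>] 0) := by
        refine limsup_le_limsup (Eventually.of_forall fun ε => ?_)
        dsimp only
        rw [← P.volIntegral_const_mul (by simp)]
        refine P.volIntegral_mono fun p => ?_
        by_cases hp : p ∈ U
        · rw [mul_left_comm]
          gcongr
          exact P.approxEnergyDensity_comp_le h ε hp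
        -- Off U the cutoff f vanishes, so the Lipschitz bound is only needed for pairs in U.
        · simp [image_eq_zero_of_notMem_tsupport fun h' => hp (hs h')]
    _ = C ^ 2 * limsup (fun ε : ℝ => P.volIntegral fun p =>
        ENNReal.ofReal (f p) * P.approxEnergyDensity dY U φ ε p) (𝓝[>] 0) :=
        ENNReal.limsup_const_mul_of_ne_top (by simp)
    _ ≤ C ^ 2 * P.energy dY U φ := by
        gcongr
        exact le_iSup_of_le f <| le_iSup_of_le hf <| le_iSup_of_le hc <| le_iSup_of_le hs <|
          le_iSup_of_le h01 le_rfl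

end AdmissibleRiemannianPolyhedron

/-! ### Lipschitz estimates for the Riemannian distance -/

section Riemannian

variable {E : Type*} [NormedAddCommGroup E] [NormedSpace ℝ E]
  {H : Type*} [TopologicalSpace H] (I : ModelWithCorners ℝ E H)
  {M : Type*} [TopologicalSpace M] [ChartedSpace H M]
  [RiemannianBundle (fun x : M => TangentSpace I x)] [IsManifold I 1 M]

theorem eventually_enorm_mfderiv_extChartAt_apply_le
    [IsContinuousRiemannianBundle E (fun x : M => TangentSpace I x)] (x : M) :
    ∃ C : ℝ≥0, ∀ᶠ y in 𝓝 x, ∀ v : TangentSpace I y,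
      enorm (E := E) (mfderiv I 𝓘(ℝ, E) (extChartAt I x) y v) ≤ C * ‖v‖ₑ := by
  obtain ⟨C, -, hC⟩ := eventually_enorm_mfderiv_extChartAt_lt I x
  refine ⟨C, ?_⟩
  filter_upwards [hC] with y hy v
  exact (ContinuousLinearMap.le_opENorm _ _).trans (mul_le_mul_left hy.le _)

/-- The chart image of γ is a C¹ curve in E. The distance of its endpoints is at most the integral
of its speed, which by the chain rule and `hC` is at most C times the Riemannian speed of γ. -/
theorem edist_extChartAt_le_pathELength {x : M} {C : ℝ≥0} {γ : ℝ → M} (hγ : ContMDiff 𝓘(ℝ, ℝ) I 1 γ)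
    (hs : ∀ t ∈ Icc (0 : ℝ) 1, γ t ∈ (chartAt H x).source)
    (hC : ∀ t ∈ Icc (0 : ℝ) 1, ∀ v : TangentSpace I (γ t),
      enorm (E := E) (mfderiv I 𝓘(ℝ, E) (extChartAt I x) (γ t) v) ≤ C * ‖v‖ₑ) :
    edist (extChartAt I x (γ 0)) (extChartAt I x (γ 1)) ≤ C * pathELength I γ 0 1 := by
  let γ' := extChartAt I x ∘ γ
  have hγ' : ContMDiffOn 𝓘(ℝ, ℝ) 𝓘(ℝ, E) 1 γ' (Icc 0 1) :=
    contMDiffOn_extChartAt.comp (I' := I) (t := (chartAt H x).source) hγ.contMDiffOn hs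
  rw [edist_comm, edist_eq_enorm_sub]
  calc
    ‖γ' 1 - γ' 0‖ₑ
    _ ≤ ∫⁻ t in Icc 0 1, ‖derivWithin γ' (Icc 0 1) t‖ₑ := by
      apply enorm_sub_le_lintegral_derivWithin_Icc_of_contDiffOn_Icc _ zero_le_one
      rwa [← contMDiffOn_iff_contDiffOn]
    _ = ∫⁻ t in Icc 0 1, enorm (E := E) (mfderivWithin 𝓘(ℝ, ℝ) 𝓘(ℝ, E) γ' (Icc 0 1) t 1) := by
      simp_rw [← fderivWithin_derivWithin, mfderivWithin_eq_fderivWithin]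
      rfl
    _ ≤ ∫⁻ t in Icc 0 1, C * ‖mfderivWithin 𝓘(ℝ, ℝ) I γ (Icc 0 1) t 1‖ₑ := by
      apply setLIntegral_mono' measurableSet_Icc (fun t ht ↦ ?_)
      have : mfderivWithin 𝓘(ℝ, ℝ) 𝓘(ℝ, E) γ' (Icc 0 1) t =
          (mfderiv I 𝓘(ℝ, E) (extChartAt I x) (γ t)) ∘L
            (mfderivWithin 𝓘(ℝ, ℝ) I γ (Icc 0 1) t) := by
        apply mfderiv_comp_mfderivWithin
        · exact mdifferentiableAt_extChartAt (hs t ht)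
        · exact (hγ.mdifferentiable one_ne_zero).mdifferentiableOn _ ht
        · rw [uniqueMDiffWithinAt_iff_uniqueDiffWithinAt]
          exact uniqueDiffOn_Icc zero_lt_one _ ht
      have : mfderivWithin 𝓘(ℝ, ℝ) 𝓘(ℝ, E) γ' (Icc 0 1) t 1 =
          (mfderiv I 𝓘(ℝ, E) (extChartAt I x) (γ t))
            (mfderivWithin 𝓘(ℝ, ℝ) I γ (Icc 0 1) t 1) := congr($this 1)
      rw [this]
      exact hC t ht _
    _ = C * pathELength I γ 0 1 := by
      rw [lintegral_const_mul' _ _ ENNReal.coe_ne_top, pathELength_eq_lintegral_mfderivWithin_Icc]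

variable [IsContinuousRiemannianBundle E (fun x : M => TangentSpace I x)] [RegularSpace M]

/-- Nearly minimizing paths between points close to x stay in the neighbourhood of x where the
derivative of the chart is bounded, so the path estimate applies to them. -/
theorem exists_edist_extChartAt_le_riemannianEDist (x : M) :
    ∃ C : ℝ≥0, ∃ u ∈ 𝓝 x, ∀ y ∈ u, ∀ z ∈ u,
      edist (extChartAt I x y) (extChartAt I x z) ≤ C * riemannianEDist I y z := by
  obtain ⟨C, hC⟩ := eventually_enorm_mfderiv_extChartAt_apply_le I x
  obtain ⟨c, hc, hsub⟩ := setOfPred_riemannianEDist_lt_subset_nhds I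
    (inter_mem hC (chart_source_mem_nhds H x))
  -- With y, z within c/3 of x, a path from y to z of length below 2c/3 stays in the c-ball around
  -- x.
  have hc3 : (0 : ℝ≥0∞) < c / 3 := ENNReal.div_pos (by simpa using hc.ne') (by simp)
  refine ⟨C, {y | riemannianEDist I x y < c / 3}, eventually_riemannianEDist_lt I x hc3,
    fun y hy z hz => ?_⟩
  have hyz : riemannianEDist I y z < c / 3 + c / 3 := by
    refine (riemannianEDist_triangle (y := x)).trans_lt ?_
    rw [riemannianEDist_comm]
    exact ENNReal.add_lt_add hy hz
  -- The infimum over paths need not be attained, so the bound is proved for every slightly larger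
  -- r.
  suffices h : ∀ r : ℝ≥0∞, riemannianEDist I y z < r → r < c / 3 + c / 3 →
      edist (extChartAt I x y) (extChartAt I x z) ≤ C * r by
    refine ENNReal.le_mul_of_forall_lt (.inr hyz.ne_top) (.inl ENNReal.coe_ne_top)
      fun a ha b hb => ?_
    obtain ⟨r, hr, hr'⟩ := ENNReal.lt_iff_exists_nnreal_btwn.1 (lt_min hb hyz)
    exact (h r hr (hr'.trans_le (min_le_right _ _))).trans
      (mul_le_mul' ha.le (hr'.le.trans (min_le_left _ _)))
  intro r hr hrc
  obtain ⟨γ, rfl, rfl, hγ, hlen, -⟩ := exists_lt_locally_constant_of_riemannianEDist_lt hr zero_lt_one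
  have hmem : ∀ t ∈ Icc (0 : ℝ) 1, γ t ∈
      {y | ∀ v : TangentSpace I y,
        enorm (E := E) (mfderiv I 𝓘(ℝ, E) (extChartAt I x) y v) ≤ C * ‖v‖ₑ} ∩ (chartAt H x).source := fun t ht => by
    refine hsub ?_
    calc riemannianEDist I x (γ t)
        ≤ riemannianEDist I x (γ 0) + riemannianEDist I (γ 0) (γ t) := riemannianEDist_triangle
      _ < c / 3 + (c / 3 + c / 3) := by
        refine ENNReal.add_lt_add hy (lt_of_le_of_lt ?_ (hlen.trans hrc))
        exact (riemannianEDist_le_pathELength hγ.contMDiffOn rfl rfl ht.1).trans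
          (pathELength_mono le_rfl ht.2)
      _ = c := by rw [← add_assoc, ENNReal.add_thirds]
  exact (edist_extChartAt_le_pathELength I hγ (fun t ht => (hmem t ht).2)
    fun t ht => (hmem t ht).1).trans (by gcongr)

end Riemannian

/-- A map which is continuous and locally Lipschitz along a compact set is Lipschitz on it. -/
theorem IsCompact.exists_lipschitzOnWith {α β : Type*} [EMetricSpace α] [PseudoMetricSpace β]
    {f : α → β} {K : Set α} (hK : IsCompact K) (hf : LocallyLipschitzOn K f) :
    ∃ C, LipschitzOnWith C f K := by
  suffices h : ∃ C : ℝ≥0, ∀ p ∈ K ×ˢ K, edist (f p.1) (f p.2) ≤ C * edist p.1 p.2 by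
    obtain ⟨C, hC⟩ := h
    exact ⟨C, fun y hy z hz => hC (y, z) ⟨hy, hz⟩⟩
  -- Compactness of K × K: it suffices to find a constant near each pair, and finite unions take the
  -- maximum.
  refine (hK.prod hK).induction_on ⟨0, by simp⟩ (fun s t hst ⟨C, hC⟩ => ⟨C, fun p hp => hC p (hst hp)⟩)
    (fun s t ⟨C, hC⟩ ⟨C', hC'⟩ => ⟨max C C', ?_⟩) ?_
  · rintro p (hp | hp)
    · exact (hC p hp).trans (by gcongr; exact le_max_left _ _)
    · exact (hC' p hp).trans (by gcongr; exact le_max_right _ _)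
  · rintro ⟨y, z⟩ ⟨hy, hz⟩
    by_cases hyz : y = z
    · subst hyz
      obtain ⟨C, t, ht, hC⟩ := hf hy
      exact ⟨t ×ˢ t, by rw [nhdsWithin_prod_eq]; exact prod_mem_prod ht ht, C,
        fun p hp => hC hp.1 hp.2⟩
    -- Off the diagonal, nearby pairs stay more than δ apart while their images stay within R, so R
    -- / δ works.
    · obtain ⟨δ, hδ, hδ'⟩ := ENNReal.lt_iff_exists_nnreal_btwn.1 (edist_pos.2 hyz)
      obtain ⟨R, hR, -⟩ := ENNReal.lt_iff_exists_nnreal_btwn.1 (edist_lt_top (f y) (f z))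
      have hcont : ContinuousWithinAt (fun p : α × α => edist (f p.1) (f p.2)) (K ×ˢ K) (y, z) :=
        continuous_edist.comp_continuousOn
          ((hf.continuousOn.comp continuousOn_fst fun _ hp => (mem_prod.1 hp).1).prodMk
            (hf.continuousOn.comp continuousOn_snd fun _ hp => (mem_prod.1 hp).2)) (y, z) ⟨hy, hz⟩
      refine ⟨_, inter_mem (hcont.eventually_lt_const hR)
        (nhdsWithin_le_nhds ((continuous_edist.tendsto (y, z)).eventually_const_lt hδ')), R / δ,
        fun p hp => ?_⟩
      have hδ0 : δ ≠ 0 := by simpa using hδ.ne'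
      calc edist (f p.1) (f p.2) ≤ R := hp.1.le
        _ = (R / δ : ℝ≥0) * δ := by rw [← ENNReal.coe_mul, div_mul_cancel₀ _ hδ0]
        _ ≤ (R / δ : ℝ≥0) * edist p.1 p.2 := by gcongr; exact hp.2.le

/-! ### Local holomorphic functions and their Lipschitz bounds -/

section Holomorphic

variable {E : Type*} [NormedAddCommGroup E] [NormedSpace ℂ E]
  {N : Type*} [TopologicalSpace N] [ChartedSpace E N]

theorem IsLocalHolomorphic.mono {V W : Set N} {ψ : N → ℂ} (h : IsLocalHolomorphic E V ψ)
    (hW : IsOpen W) (hWV : W ⊆ V) : IsLocalHolomorphic E W ψ :=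
  ⟨hW, h.2.mono hWV⟩

theorem IsLocalHolomorphic.add {V : Set N} {v w : N → ℂ} (hv : IsLocalHolomorphic E V v)
    (hw : IsLocalHolomorphic E V w) : IsLocalHolomorphic E V (v + w) :=
  ⟨hv.1, hv.2.add hw.2⟩

theorem IsLocalHolomorphic.comp {V : Set N} {V' : Set ℂ} {ψ : N → ℂ} {v : ℂ → ℂ}
    (hv : IsLocalHolomorphic ℂ V' v) (hψ : IsLocalHolomorphic E V ψ) :
    IsLocalHolomorphic E (V ∩ ψ ⁻¹' V') (v ∘ ψ) :=
  ⟨hψ.2.continuousOn.isOpen_inter_preimage hψ.1 hv.1,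
    hv.2.comp (hψ.2.mono inter_subset_left) inter_subset_right⟩

theorem isLocalHolomorphic_id : IsLocalHolomorphic ℂ (univ : Set ℂ) (id : ℂ → ℂ) :=
  ⟨isOpen_univ, contMDiffOn_id⟩

variable [IsManifold 𝓘(ℂ, E) ω N] [RiemannianBundle (fun x : N => TangentSpace 𝓘(ℝ, E) x)]
  [IsContinuousRiemannianBundle E (fun x : N => TangentSpace 𝓘(ℝ, E) x)]

/-- Read in a chart, ψ is C¹, hence locally Lipschitz for the norm of E; the chart itself is locally
Lipschitz for the Riemannian distance. -/
theorem IsLocalHolomorphic.exists_edist_le_riemannianEDist [RegularSpace N] {V : Set N} {ψ : N → ℂ}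
    (hψ : IsLocalHolomorphic E V ψ) {x : N} (hx : x ∈ V) :
    ∃ C : ℝ≥0, ∃ u ∈ 𝓝 x, ∀ y ∈ u, ∀ z ∈ u,
      edist (ψ y) (ψ z) ≤ C * riemannianEDist 𝓘(ℝ, E) y z := by
  obtain ⟨C, u, hu, hC⟩ := exists_edist_extChartAt_le_riemannianEDist 𝓘(ℝ, E) x
  have hd : ContDiffAt ℂ ω (ψ ∘ (chartAt E x).symm) (chartAt E x x) := by
    have hsymm : ContMDiffAt 𝓘(ℂ, E) 𝓘(ℂ, E) ω (chartAt E x).symm (chartAt E x x) :=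
      contMDiffOn_chart_symm.contMDiffAt
        ((chartAt E x).open_target.mem_nhds (mem_chart_target E x))
    refine ContMDiffAt.contDiffAt (ContMDiffAt.comp _ ?_ hsymm)
    rw [(chartAt E x).left_inv (mem_chart_source E x)]
    exact hψ.2.contMDiffAt (hψ.1.mem_nhds hx)
  obtain ⟨L, t, ht, hL⟩ := (hd.of_le (le_top : 1 ≤ ω)).exists_lipschitzOnWith
  have hpre : chartAt E x ⁻¹' t ∈ 𝓝 x :=
    ((chartAt E x).continuousAt (mem_chart_source E x)).preimage_mem_nhds ht
  refine ⟨L * C, _, inter_mem (inter_mem hu hpre) (chart_source_mem_nhds E x), ?_⟩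
  rintro y ⟨⟨hyu, hyt⟩, hys⟩ z ⟨⟨hzu, hzt⟩, hzs⟩
  have h := hL hyt hzt
  simp only [Function.comp_apply, (chartAt E x).left_inv hys, (chartAt E x).left_inv hzs] at h
  refine h.trans ?_
  rw [ENNReal.coe_mul, mul_assoc]
  gcongr
  simpa using hC y hyu z hzu

theorem IsLocalHolomorphic.exists_edist_le_riemannianEDist_of_isCompact [T3Space N] {V K : Set N}
    {ψ : N → ℂ} (hψ : IsLocalHolomorphic E V ψ) (hK : IsCompact K) (hKV : K ⊆ V) :
    ∃ C : ℝ≥0, ∀ y ∈ K, ∀ z ∈ K, edist (ψ y) (ψ z) ≤ C * riemannianEDist 𝓘(ℝ, E) y z := by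
  -- This makes `riemannianEDist` the `edist` of N, compatibly with its topology, so the compactness
  -- lemma applies.
  let : EMetricSpace N := EMetricSpace.ofRiemannianMetric 𝓘(ℝ, E) N
  have hf : LocallyLipschitzOn K ψ := fun x hx => by
    obtain ⟨C, u, hu, h⟩ := hψ.exists_edist_le_riemannianEDist (hKV hx)
    exact ⟨C, u, nhdsWithin_le_nhds hu, h⟩
  exact hK.exists_lipschitzOnWith hf

end Holomorphic

/-! ### Composition with holomorphic functions and the equivalence -/

namespace AdmissibleRiemannianPolyhedron

variable {X : Type*} [TopologicalSpace X] {m : ℕ} (P : AdmissibleRiemannianPolyhedron X m)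
  {E : Type*} [NormedAddCommGroup E] [NormedSpace ℂ E]
  {N : Type*} [TopologicalSpace N] [ChartedSpace E N] [IsManifold 𝓘(ℂ, E) ω N]
  [RiemannianBundle (fun x : N => TangentSpace 𝓘(ℝ, E) x)]

/-- The composition of a continuous map locally of finite energy with a local holomorphic function
is locally of finite energy. -/
theorem IsW12Loc.comp_isLocalHolomorphic [T3Space N]
    [IsContinuousRiemannianBundle E (fun x : N => TangentSpace 𝓘(ℝ, E) x)]
    {φ : X → N} (hW : P.IsW12Loc E univ φ) (hφ : Continuous φ) {V : Set N} {ψ : N → ℂ}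
    (hψ : IsLocalHolomorphic E V ψ) : P.IsW12Loc ℂ (φ ⁻¹' V) (ψ ∘ φ) := by
  intro U hU hUc hUK hUV
  obtain ⟨C, hC⟩ := hψ.exists_edist_le_riemannianEDist_of_isCompact (hUK.image hφ)
    (image_subset_iff.2 hUV)
  refine (P.energy_comp_le (C := C) (dY := riemannianEDist 𝓘(ℝ, E)) fun p hp q hq => ?_).trans_lt
    (ENNReal.mul_lt_top (by simp) (hW U hU hUc hUK (subset_univ _)))
  -- On ℂ the Riemannian distance is the Euclidean one.
  rw [← IsRiemannianManifold.out (I := 𝓘(ℝ, ℂ))]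
  exact hC _ (mem_image_of_mem φ (subset_closure hp)) _ (mem_image_of_mem φ (subset_closure hq))

theorem IsPHWC.comp_isLocalHolomorphic [T3Space N]
    [IsContinuousRiemannianBundle E (fun x : N => TangentSpace 𝓘(ℝ, E) x)]
    {φ : X → N} (h : P.IsPHWC E univ φ) {V : Set N} {ψ : N → ℂ}
    (hψ : IsLocalHolomorphic E V ψ) : P.IsPHWC ℂ (φ ⁻¹' V) (ψ ∘ φ) := by
  have hφ : Continuous φ := continuousOn_univ.1 h.1
  refine ⟨hψ.2.continuousOn.comp hφ.continuousOn fun p hp => hp,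
    IsW12Loc.comp_isLocalHolomorphic P h.2.1 hφ hψ, fun V' W' v w hv hw => ?_⟩
  have key := h.2.2 _ _ _ _ (hv.comp hψ) (hw.comp hψ)
  have hO : univ ∩ φ ⁻¹' ((V ∩ ψ ⁻¹' V') ∩ (V ∩ ψ ⁻¹' W')) =
      φ ⁻¹' V ∩ (ψ ∘ φ) ⁻¹' (V' ∩ W') := by
    ext p
    simp only [mem_inter_iff, mem_preimage, mem_univ, Function.comp_apply]
    tauto
  rwa [hO] at key

end AdmissibleRiemannianPolyhedron

theorem proposition3p5
    {X : Type*} [TopologicalSpace X] {m : ℕ} (P : AdmissibleRiemannianPolyhedron X m)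
    {E : Type*} [NormedAddCommGroup E] [NormedSpace ℂ E] [FiniteDimensional ℂ E]
    {N : Type*} [TopologicalSpace N] [T2Space N] [SecondCountableTopology N]
    [ChartedSpace E N] [IsManifold 𝓘(ℂ, E) ω N]
    [RiemannianBundle (fun x : N => TangentSpace 𝓘(ℝ, E) x)]
    [IsContMDiffRiemannianBundle 𝓘(ℝ, E) ∞ E (fun x : N => TangentSpace 𝓘(ℝ, E) x)]
    (hN : IsHermitianMetric E N)
    (φ : X → N) (hφ : Continuous φ) (hφW : P.IsW12Loc E univ φ) :
    P.IsPHWC E univ φ ↔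
      ∀ (V : Set N) (ψ : N → ℂ), IsLocalHolomorphic E V ψ →
        P.IsPHWC ℂ (φ ⁻¹' V) (ψ ∘ φ) := by
  have : ProperSpace E := FiniteDimensional.proper ℂ E
  -- With the Hausdorff property this makes N a T3 space, as the Lipschitz estimates require.
  have : LocallyCompactSpace N := ChartedSpace.locallyCompactSpace E N
  have : IsContinuousRiemannianBundle E (fun x : N => TangentSpace 𝓘(ℝ, E) x) := by
    obtain ⟨g, hg, h⟩ := IsContMDiffRiemannianBundle.exists_contMDiff (IB := 𝓘(ℝ, E)) (n := ∞)
      (F := E) (E := fun x : N => TangentSpace 𝓘(ℝ, E) x)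
    exact ⟨g, hg.continuous, h⟩
  refine ⟨fun h V ψ hψ => h.comp_isLocalHolomorphic P hψ,
    fun h => ⟨hφ.continuousOn, hφW, fun V W v w hv hw => ?_⟩⟩
  have hVW : IsOpen (V ∩ W) := hv.1.inter hw.1
  -- The common domain V ∩ W is used because v + w is holomorphic only there.
  have hself : ∀ ψ : N → ℂ, IsLocalHolomorphic E (V ∩ W) ψ →
      P.ConformalPair (univ ∩ φ ⁻¹' (V ∩ W)) φ ψ ψ := fun ψ hψ => by
    have key := (h _ ψ hψ).2.2 univ univ id id isLocalHolomorphic_id isLocalHolomorphic_id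
    rwa [inter_self, preimage_univ, inter_univ, ← univ_inter (φ ⁻¹' (V ∩ W))] at key
  have hv' := hv.mono hVW inter_subset_left
  have hw' := hw.mono hVW inter_subset_right
  exact AdmissibleRiemannianPolyhedron.ConformalPair.polarize P
    (isOpen_univ.inter (hVW.preimage hφ)) (hself v hv') (hself w hw') (hself _ (hv'.add hw'))
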